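/- Let $S\subset\mathbb{R}^d$ be nonempty and closed, and let $\textrm{usc-fcns}(S)$ be the set of upper semicontinuous functions $f:S\to[-\infty,\infty]$ with $f\not\equiv-\infty$. For such $f$ let $\mathrm{hypo}\,f=\{(x,\alpha)\in S\times\mathbb{R} : f(x)\ge\alpha\}$. Fix any norm $\|\cdot\|$ on $\mathbb{R}^d\times\mathbb{R}$, with point-to-set distance $\mathrm{dist}$, and any point $\bar c\in S\times\mathbb{R}$. The Attouch–Wets (aw-)distance on $\textrm{usc-fcns}(S)$ is $$ d(f,g)=\int_0^\infty d_\rho(f,g)\,e^{-\rho}\,d\rho,\qquad d_\rho(f,g)=\max\big\{|\mathrm{dist}(z,\mathrm{hypo}\,f)-\mathrm{dist}(z,\mathrm{hypo}\,g)| : \|z-\bar c\|\le\rho\big\}. $$ Convergence, closedness and lower semicontinuity below refer to $d$. A function $\phi:F\to(-\infty,\infty]$ is lower semicontinuous (lsc) if $\liminf_k\phi(f^k)\ge\phi(f)$ whenever $f^k,f\in F$ and $d(f^k,f)\to0$. **Theorem 3.1 (existence of estimates).** Let $\varepsilon\in[0,\infty)$, $n\ge1$ and $x^1,\dots,x^n\in\mathbb{R}^{d_0}$.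 Let $F$ be a nonempty closed subset of $\textrm{usc-fcns}(S)$ for which there is $(x,\alpha)\in S\times\mathbb{R}$ with $f(x)\ge\alpha$ for all $f\in F$. If $\pi:F\to(-\infty,\infty]$ and $\psi(x^j,\cdot):F\to(-\infty,\infty]$, $j=1,\dots,n$, are lsc, then with $\Phi(f)=\frac1n\sum_{j=1}^n\psi(x^j,f)+\pi(f)$, $$ \{f\in F : \Phi(f)\le \inf_{g\in F}\Phi(g)+\varepsilon\}\neq\emptyset\qquad\text{and}\qquad \inf_{f\in F}\Phi(f)>-\infty, $$ where the infimum may be $+\infty$. -/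

import Mathlib

open Filter Topology

namespace AttouchWets

/-- The set `usc-fcns(S)` of upper semicontinuous functions `f : S → [-∞, ∞]`
that are not identically `-∞`. -/
def UscFcns {d : ℕ} (S : Set (EuclideanSpace ℝ (Fin d))) : Type :=
  {f : S → EReal // UpperSemicontinuous f ∧ ∃ x, f x ≠ ⊥}

variable {d : ℕ} {S : Set (EuclideanSpace ℝ (Fin d))}

/-- The hypograph `{(x, α) ∈ S × ℝ | f x ≥ α}`, as a subset of `ℝᵈ × ℝ`. -/
def hypo (f : UscFcns S) : Set (EuclideanSpace ℝ (Fin d) × ℝ) :=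
  {z | ∃ h : z.1 ∈ S, (z.2 : EReal) ≤ f.1 ⟨z.1, h⟩}

/-- The distance from the point `z` to the set `A`, measured with `N` (which will be a norm). -/
noncomputable def pointDist (N : Seminorm ℝ (EuclideanSpace ℝ (Fin d) × ℝ))
    (z : EuclideanSpace ℝ (Fin d) × ℝ) (A : Set (EuclideanSpace ℝ (Fin d) × ℝ)) : ℝ :=
  sInf ((fun a => N (z - a)) '' A)

/-- The `ρ`-aw-distance between `f` and `g`, with centre `c`. -/
noncomputable def awDistRho (N : Seminorm ℝ (EuclideanSpace ℝ (Fin d) × ℝ))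
    (c : EuclideanSpace ℝ (Fin d) × ℝ) (ρ : ℝ) (f g : UscFcns S) : ℝ :=
  sSup ((fun z => |pointDist N z (hypo f) - pointDist N z (hypo g)|) '' {z | N (z - c) ≤ ρ})

/-- The Attouch–Wets (aw-)distance between `f` and `g`, for the norm `N` and the centre `c`. The
integrand is nondecreasing times `exp (-ρ)`, with the first factor bounded by `ρ` plus a constant,
so the integral converges. -/
noncomputable def awDist (N : Seminorm ℝ (EuclideanSpace ℝ (Fin d) × ℝ))
    (c : EuclideanSpace ℝ (Fin d) × ℝ) (f g : UscFcns S) : ℝ :=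
  ∫ ρ in Set.Ioi (0 : ℝ), awDistRho N c ρ f g * Real.exp (-ρ)

/-- `u k → f` in the aw-distance. -/
def AwTendsto (N : Seminorm ℝ (EuclideanSpace ℝ (Fin d) × ℝ))
    (c : EuclideanSpace ℝ (Fin d) × ℝ) (u : ℕ → UscFcns S) (f : UscFcns S) : Prop :=
  Tendsto (fun k => awDist N c (u k) f) atTop (𝓝 0)

/-- `F` is closed in the aw-distance: it contains the limits of its convergent sequences. -/
def AwClosed (N : Seminorm ℝ (EuclideanSpace ℝ (Fin d) × ℝ))
    (c : EuclideanSpace ℝ (Fin d) × ℝ) (F : Set (UscFcns S)) : Prop :=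
  ∀ (u : ℕ → UscFcns S) (f : UscFcns S), (∀ k, u k ∈ F) → AwTendsto N c u f → f ∈ F

/-- `φ : F → [-∞, ∞]` is lower semicontinuous for the aw-distance:
`liminf φ(fᵏ) ≥ φ(f)` whenever `fᵏ ∈ F` converges to `f ∈ F`. -/
def AwLsc (N : Seminorm ℝ (EuclideanSpace ℝ (Fin d) × ℝ))
    (c : EuclideanSpace ℝ (Fin d) × ℝ) {F : Set (UscFcns S)} (φ : F → EReal) : Prop :=
  ∀ (u : ℕ → F) (f : F), AwTendsto N c (fun k => (u k : UscFcns S)) f →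
    φ f ≤ liminf (fun k => φ (u k)) atTop

/-- The set of `ε`-minimizers of `φ`. -/
def epsArgmin {X : Type*} (φ : X → EReal) (ε : ℝ) : Set X :=
  {f | φ f ≤ (⨅ g, φ g) + (ε : EReal)}

/-- The penalized empirical objective `f ↦ (1/n) ∑ⱼ ψ(xʲ, f) + π(f)`. -/
noncomputable def empObjective {X : Type*} {d₀ n : ℕ} (ψ : EuclideanSpace ℝ (Fin d₀) → X → EReal)
    (x : Fin n → EuclideanSpace ℝ (Fin d₀)) (π : X → EReal) (f : X) : EReal :=
  ((1 / (n : ℝ) : ℝ) : EReal) * (∑ j, ψ (x j) f) + π f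

end AttouchWets

/-! The direct method, by compactness. All hypographs of members of `F` contain a common point `p`,
so their distance functions are nonnegative, nonexpansive and zero at `p`. By Arzelà–Ascoli, any
sequence of them has a subsequence converging uniformly on compact sets. The limit is the distance
function of its own zero set (`eq_pointDist_zeroSet_of_tendsto`), and that set is again a hypograph
(`exists_hypo_eq`). Dominated convergence turns uniform convergence on balls into aw-convergence
(`awTendsto_of_tendstoUniformlyOn`). Hence a minimizing sequence in the closed set `F` clusters in
`F`, and lower semicontinuity makes the cluster point an exact minimizer. The objective never takes
the value `⊥`, so its minimum is above `⊥`. -/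

namespace AttouchWets

/-! ### Norm equivalence and Arzelà–Ascoli in finite dimension -/

section Seminorm

variable {E : Type*} [NormedAddCommGroup E] [NormedSpace ℝ E] [FiniteDimensional ℝ E]

theorem continuous_seminorm_of_finiteDimensional (N : Seminorm ℝ E) : Continuous N :=
  N.convexOn.locallyLipschitz.continuous

theorem exists_norm_le_mul_seminorm (N : Seminorm ℝ E) (hN : ∀ z, N z = 0 → z = 0) :
    ∃ C : ℝ, 0 < C ∧ ∀ z, ‖z‖ ≤ C * N z := by
  have hcont := continuous_seminorm_of_finiteDimensional N
  -- The unit sphere is empty exactly when `E` is trivial. Otherwise the constant is the inverse of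
  -- the minimum of `N` on it.
  rcases (Metric.sphere (0 : E) 1).eq_empty_or_nonempty with h | h
  · refine ⟨1, one_pos, fun z => ?_⟩
    by_cases hz : z = 0
    · simp [hz]
    · have : ‖z‖⁻¹ • z ∈ Metric.sphere (0 : E) 1 := by
        simp [norm_smul, hz]
      simp [h] at this
  · obtain ⟨w, hw, hmin⟩ := (isCompact_sphere (0 : E) 1).exists_isMinOn h hcont.continuousOn
    have hw0 : w ≠ 0 := by rintro rfl; simp at hw
    have hpos : 0 < N w := lt_of_le_of_ne (apply_nonneg N w) fun h0 => hw0 (hN w h0.symm)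
    refine ⟨(N w)⁻¹, inv_pos.2 hpos, fun z => ?_⟩
    by_cases hz : z = 0
    · simp [hz]
    · have hmem : ‖z‖⁻¹ • z ∈ Metric.sphere (0 : E) 1 := by
        simp [norm_smul, hz]
      have h1 : N w ≤ N (‖z‖⁻¹ • z) := hmin hmem
      rw [map_smul_eq_mul, norm_inv, norm_norm] at h1
      have hzpos : 0 < ‖z‖ := norm_pos_iff.2 hz
      rw [inv_mul_eq_div, le_div_iff₀ hzpos] at h1
      rw [inv_mul_eq_div, le_div_iff₀ hpos]
      linarith

theorem isCompact_seminorm_closedBall (N : Seminorm ℝ E) (hN : ∀ z, N z = 0 → z = 0)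
    (c : E) (ρ : ℝ) : IsCompact {z | N (z - c) ≤ ρ} := by
  have hcont := continuous_seminorm_of_finiteDimensional N
  obtain ⟨C, hC, hle⟩ := exists_norm_le_mul_seminorm N hN
  refine (isCompact_closedBall c (C * ρ)).of_isClosed_subset
    (isClosed_le (hcont.comp (continuous_id.sub continuous_const)) continuous_const) ?_
  intro z hz
  rw [Metric.mem_closedBall, dist_eq_norm]
  exact (hle _).trans (mul_le_mul_of_nonneg_left hz hC.le)

/-- Arzelà–Ascoli for nonnegative functions that are nonexpansive for a seminorm and vanish at a
common point. -/
theorem exists_subseq_tendsto_of_nonexpansive (N : Seminorm ℝ E) (p : E) (D : ℕ → E → ℝ)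
    (hnonneg : ∀ k z, 0 ≤ D k z) (hzero : ∀ k, D k p = 0)
    (hlip : ∀ k z w, |D k z - D k w| ≤ N (z - w)) :
    ∃ (D' : E → ℝ) (φ : ℕ → ℕ), StrictMono φ ∧
      ∀ K, IsCompact K → TendstoUniformlyOn (fun k => D (φ k)) D' atTop K := by
  have hcont := continuous_seminorm_of_finiteDimensional N
  have hcontD : ∀ g : E → ℝ, (∀ z w, |g z - g w| ≤ N (z - w)) → Continuous g := by
    intro g hg
    rw [continuous_iff_continuousAt]
    intro z
    rw [ContinuousAt, tendsto_iff_dist_tendsto_zero]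
    refine squeeze_zero (fun _ => dist_nonneg) (fun w => hg w z) ?_
    have := (hcont.comp (continuous_id.sub (continuous_const (y := z)))).tendsto z
    simpa [Function.comp_def] using this
  let T : Set C(E, ℝ) :=
    {g | (∀ z, 0 ≤ g z) ∧ g p = 0 ∧ ∀ z w, |g z - g w| ≤ N (z - w)}
  -- Nonexpansiveness already gives continuity, and the factor at `p` is `{0}`. So the image is a
  -- closed subset of a product of compact intervals.
  have himage : ContinuousMap.toFun '' T =
      Set.pi Set.univ (fun z => Set.Icc 0 (N (z - p))) ∩
        {g : E → ℝ | ∀ z w, |g z - g w| ≤ N (z - w)} := by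
    ext g
    constructor
    · rintro ⟨g, ⟨h0, hp, hl⟩, rfl⟩
      refine ⟨fun z _ => ⟨h0 z, ?_⟩, hl⟩
      have := hl z p
      rw [hp, sub_zero] at this
      exact (le_abs_self _).trans this
    · rintro ⟨h1, hl⟩
      refine ⟨⟨g, hcontD g hl⟩, ⟨fun z => (h1 z trivial).1, ?_, hl⟩, rfl⟩
      have := h1 p trivial
      simp only [sub_self, map_zero, Set.Icc_self, Set.mem_singleton_iff] at this
      exact this
  have hT : IsCompact T := by
    apply ArzelaAscoli.isCompact_of_equicontinuous
    · rw [himage]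
      refine (isCompact_univ_pi fun z => isCompact_Icc).inter_right ?_
      simp only [Set.ofPred_forall]
      exact isClosed_iInter fun z => isClosed_iInter fun w =>
        isClosed_le (((continuous_apply z).sub (continuous_apply w)).abs) continuous_const
    · intro z
      rw [Metric.equicontinuousAt_iff]
      intro δ hδ
      have h0 : Tendsto (fun w => N (w - z)) (𝓝 z) (𝓝 0) := by
        have := (hcont.comp (continuous_id.sub (continuous_const (y := z)))).tendsto z
        simpa [Function.comp_def] using this
      obtain ⟨r, hr, hball⟩ := Metric.eventually_nhds_iff.1 (h0.eventually_lt_const hδ)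
      refine ⟨r, hr, fun w hw g => ?_⟩
      rw [dist_comm, Real.dist_eq]
      exact (g.2.2.2 w z).trans_lt (hball hw)
  let G : ℕ → C(E, ℝ) := fun k => ⟨D k, hcontD _ (hlip k)⟩
  -- A pseudometric for the compact-open uniformity lets compactness yield subsequences.
  let : PseudoMetricSpace C(E, ℝ) := UniformSpace.pseudoMetricSpace _
  obtain ⟨g, -, φ, hφ, hg⟩ := hT.tendsto_subseq (x := G) fun k => ⟨hnonneg k, hzero k, hlip k⟩
  exact ⟨g, φ, hφ, fun K hK =>
    ContinuousMap.tendsto_iff_forall_isCompact_tendstoUniformlyOn.1 hg K hK⟩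

end Seminorm

variable {d : ℕ} {S : Set (EuclideanSpace ℝ (Fin d))}

/-! ### Point-to-set distances and their pointwise limits -/

section PointDist

variable (N : Seminorm ℝ (EuclideanSpace ℝ (Fin d) × ℝ))
  {A : Set (EuclideanSpace ℝ (Fin d) × ℝ)}

theorem pointDist_le (z : EuclideanSpace ℝ (Fin d) × ℝ) {a : EuclideanSpace ℝ (Fin d) × ℝ}
    (ha : a ∈ A) : pointDist N z A ≤ N (z - a) :=
  csInf_le ⟨0, by rintro _ ⟨b, -, rfl⟩; exact apply_nonneg N _⟩ ⟨a, ha, rfl⟩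

theorem pointDist_nonneg (z : EuclideanSpace ℝ (Fin d) × ℝ) : 0 ≤ pointDist N z A :=
  Real.sInf_nonneg (by rintro _ ⟨b, -, rfl⟩; exact apply_nonneg N _)

theorem pointDist_eq_zero_of_mem {z : EuclideanSpace ℝ (Fin d) × ℝ} (hz : z ∈ A) :
    pointDist N z A = 0 :=
  le_antisymm (by simpa using pointDist_le N z hz) (pointDist_nonneg N z)

theorem exists_lt_pointDist_add (hA : A.Nonempty) (z : EuclideanSpace ℝ (Fin d) × ℝ) {δ : ℝ}
    (hδ : 0 < δ) : ∃ a ∈ A, N (z - a) < pointDist N z A + δ := by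
  obtain ⟨_, ⟨a, ha, rfl⟩, hlt⟩ :=
    exists_lt_of_csInf_lt (hA.image fun a => N (z - a)) (lt_add_of_pos_right (pointDist N z A) hδ)
  exact ⟨a, ha, hlt⟩

theorem le_pointDist (hA : A.Nonempty) {z : EuclideanSpace ℝ (Fin d) × ℝ} {r : ℝ}
    (h : ∀ a ∈ A, r ≤ N (z - a)) : r ≤ pointDist N z A :=
  le_csInf (hA.image _) (by rintro _ ⟨a, ha, rfl⟩; exact h a ha)

theorem abs_pointDist_sub_le (hA : A.Nonempty) (z w : EuclideanSpace ℝ (Fin d) × ℝ) :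
    |pointDist N z A - pointDist N w A| ≤ N (z - w) := by
  have key : ∀ z w, pointDist N z A - N (z - w) ≤ pointDist N w A := fun z w =>
    le_pointDist N hA fun a ha => by
      have h1 := pointDist_le N z ha
      have h2 := map_add_le_add N (z - w) (w - a)
      rw [sub_add_sub_cancel] at h2
      linarith
  rw [abs_sub_le_iff]
  have h1 := key z w
  have h2 := key w z
  rw [map_sub_rev] at h2
  constructor <;> linarith

variable {N} in
/-- A pointwise limit of distance functions of sets with a common point is the distance function of
its zero set. -/
theorem eq_pointDist_zeroSet_of_tendsto (hN : ∀ z, N z = 0 → z = 0)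
    {B : ℕ → Set (EuclideanSpace ℝ (Fin d) × ℝ)} {D : EuclideanSpace ℝ (Fin d) × ℝ → ℝ}
    {p : EuclideanSpace ℝ (Fin d) × ℝ} (hp : ∀ k, p ∈ B k)
    (hD : ∀ z, Tendsto (fun k => pointDist N z (B k)) atTop (𝓝 (D z)))
    (z : EuclideanSpace ℝ (Fin d) × ℝ) : D z = pointDist N z {w | D w = 0} := by
  have hcont := continuous_seminorm_of_finiteDimensional N
  have hlip : ∀ z w, |D z - D w| ≤ N (z - w) := fun z w =>
    le_of_tendsto (((hD z).sub (hD w)).abs)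
      (Eventually.of_forall fun k => abs_pointDist_sub_le N ⟨p, hp k⟩ z w)
  have hDp : D p = 0 := by
    refine tendsto_nhds_unique (hD p) ?_
    simp only [pointDist_eq_zero_of_mem N (hp _)]
    exact tendsto_const_nhds
  have hD0 : ∀ w, 0 ≤ D w := fun w => ge_of_tendsto' (hD w) fun k => pointDist_nonneg N w
  apply le_antisymm
  · refine le_pointDist N ⟨p, hDp⟩ fun a ha => ?_
    have := hlip z a
    rw [show D a = 0 from ha, sub_zero] at this
    exact (le_abs_self _).trans this
  -- Almost nearest points of `B k` to `z` stay in a compact ball. A cluster point `b` lies in the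
  -- zero set and realizes the limit distance.
  · choose a ha hlt using fun k : ℕ =>
      exists_lt_pointDist_add N ⟨p, hp k⟩ z (Nat.one_div_pos_of_nat (α := ℝ) (n := k))
    have hbdd : ∀ k, a k ∈ {w | N (w - z) ≤ N (z - p) + 1} := fun k => by
      have h1 := pointDist_le N z (hp k)
      have h2 : 1 / ((k : ℝ) + 1) ≤ 1 := by
        rw [div_le_one (by positivity)]
        linarith [Nat.cast_nonneg (α := ℝ) k]
      rw [Set.mem_ofPred_eq, map_sub_rev]
      linarith [hlt k]
    obtain ⟨b, -, φ, hφ, hb⟩ := (isCompact_seminorm_closedBall N hN z _).tendsto_subseq hbdd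
    have hDb : D b = 0 := by
      refine le_antisymm (le_of_tendsto_of_tendsto' ((hD b).comp hφ.tendsto_atTop) ?_
        fun k => pointDist_le N b (ha (φ k))) (hD0 b)
      have := (hcont.tendsto _).comp ((tendsto_const_nhds (x := b)).sub hb)
      simpa [Function.comp_def] using this
    refine (pointDist_le N z (a := b) hDb).trans ?_
    have h1 : Tendsto (fun k => N (z - a (φ k))) atTop (𝓝 (N (z - b))) :=
      (hcont.tendsto _).comp (tendsto_const_nhds.sub hb)
    have h2 := ((hD z).add tendsto_one_div_add_atTop_nhds_zero_nat).comp hφ.tendsto_atTop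
    rw [add_zero] at h2
    exact le_of_tendsto_of_tendsto' h1 h2 fun k => (hlt (φ k)).le

end PointDist

/-! ### Which sets are hypographs -/

section Hypograph

theorem hypo_nonempty (f : UscFcns S) : (hypo f).Nonempty := by
  obtain ⟨x, hx⟩ := f.2.2
  obtain ⟨α, -, hα⟩ := EReal.lt_iff_exists_real_btwn.1 (bot_lt_iff_ne_bot.2 hx)
  exact ⟨(x, α), x.2, hα.le⟩

theorem isClosed_hypo (hS : IsClosed S) (f : UscFcns S) : IsClosed (hypo f) := by
  have h : IsClosed {q : S × ℝ | (q.2 : EReal) ≤ f.1 q.1} := by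
    rw [← isOpen_compl_iff, isOpen_iff_mem_nhds]
    rintro ⟨x, α⟩ hx
    simp only [Set.mem_compl_iff, Set.mem_ofPred_eq, not_le] at hx
    obtain ⟨β, hβ, hβα⟩ := EReal.lt_iff_exists_real_btwn.1 hx
    have h1 := f.2.1 x β hβ
    have h2 := lt_mem_nhds (EReal.coe_lt_coe_iff.1 hβα)
    filter_upwards [prod_mem_nhds h1 h2] with q hq
    simp only [Set.mem_compl_iff, Set.mem_ofPred_eq, not_le]
    exact hq.1.trans (EReal.coe_lt_coe_iff.2 hq.2)
  have hemb : IsClosedEmbedding (Prod.map ((↑) : S → EuclideanSpace ℝ (Fin d)) (id : ℝ → ℝ)) :=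
    hS.isClosedEmbedding_subtypeVal.prodMap .id
  convert hemb.isClosedMap _ h using 1
  ext ⟨x, α⟩
  constructor
  · rintro ⟨hx, hle⟩
    exact ⟨(⟨x, hx⟩, α), hle, rfl⟩
  · rintro ⟨⟨y, β⟩, hle, heq⟩
    simp only [Prod.map_apply, id, Prod.mk.injEq] at heq
    obtain ⟨rfl, rfl⟩ := heq
    exact ⟨y.2, hle⟩

/-- The function is the supremum of each vertical fibre of `L`. Fibres are closed and downward
closed, so no point is gained by taking suprema. Closedness of `L` also gives upper semicontinuity.
-/
theorem exists_hypo_eq {L : Set (EuclideanSpace ℝ (Fin d) × ℝ)} (hL : IsClosed L)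
    (hne : L.Nonempty) (hsub : ∀ z ∈ L, z.1 ∈ S)
    (hdown : ∀ z ∈ L, ∀ t : ℝ, t ≤ z.2 → (z.1, t) ∈ L) : ∃ f : UscFcns S, hypo f = L := by
  let f : S → EReal := fun x =>
    ⨆ α : {α : ℝ // ((x : EuclideanSpace ℝ (Fin d)), α) ∈ L}, (α : EReal)
  have hle : ∀ (x : S) (α : ℝ), (α : EReal) ≤ f x ↔ ((x : EuclideanSpace ℝ (Fin d)), α) ∈ L := by
    intro x α
    refine ⟨fun h => ?_, fun h => le_iSup
      (fun β : {β : ℝ // ((x : EuclideanSpace ℝ (Fin d)), β) ∈ L} => ((β : ℝ) : EReal)) ⟨α, h⟩⟩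
    have hmem : ∀ β < α, ((x : EuclideanSpace ℝ (Fin d)), β) ∈ L := by
      intro β hβ
      obtain ⟨γ, hγ⟩ := lt_iSup_iff.1 ((EReal.coe_lt_coe_iff.2 hβ).trans_le h)
      exact hdown _ γ.2 β (EReal.coe_lt_coe_iff.1 hγ).le
    have hcl : IsClosed {β : ℝ | ((x : EuclideanSpace ℝ (Fin d)), β) ∈ L} :=
      hL.preimage (continuous_const.prodMk continuous_id)
    have : α ∈ closure (Set.Iio α) := by simp
    exact closure_minimal (fun β hβ => hmem β hβ) hcl this
  have husc : UpperSemicontinuous f := by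
    intro x y hy
    obtain ⟨α, hα, hαy⟩ := EReal.lt_iff_exists_real_btwn.1 hy
    have hnot : ((x : EuclideanSpace ℝ (Fin d)), α) ∉ L :=
      fun h => (hα.trans_le ((hle x α).2 h)).false
    have hopen : IsOpen {x' : S | ((x' : EuclideanSpace ℝ (Fin d)), α) ∉ L} :=
      (hL.preimage (continuous_subtype_val.prodMk continuous_const)).isOpen_compl
    filter_upwards [hopen.mem_nhds hnot] with x' hx'
    exact (not_le.1 fun h => hx' ((hle x' α).1 h)).trans hαy
  obtain ⟨z, hz⟩ := hne
  refine ⟨⟨f, husc, ⟨z.1, hsub z hz⟩, fun hbot => ?_⟩, ?_⟩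
  · have := (hle ⟨z.1, hsub z hz⟩ z.2).2 hz
    rw [hbot, le_bot_iff] at this
    exact EReal.coe_ne_bot _ this
  · ext w
    exact ⟨fun ⟨h, hw⟩ => (hle ⟨w.1, h⟩ w.2).1 hw,
      fun hw => ⟨hsub w hw, (hle ⟨w.1, hsub w hw⟩ w.2).2 hw⟩⟩

theorem hypo_mem_of_le (f : UscFcns S) {z : EuclideanSpace ℝ (Fin d) × ℝ} (hz : z ∈ hypo f)
    {t : ℝ} (ht : t ≤ z.2) : (z.1, t) ∈ hypo f :=
  ⟨hz.1, (EReal.coe_le_coe_iff.2 ht).trans hz.2⟩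

end Hypograph

/-! ### Sequential compactness for the aw-distance -/

section AwDist

variable {N : Seminorm ℝ (EuclideanSpace ℝ (Fin d) × ℝ)} {c p : EuclideanSpace ℝ (Fin d) × ℝ}

/-- Both distances lie in `[0, N (z - p)]`. The bound is uniform over such `f` and `g`, hence usable
as a dominating function. -/
theorem abs_pointDist_hypo_sub_le {f g : UscFcns S} (hf : p ∈ hypo f) (hg : p ∈ hypo g) {ρ : ℝ}
    {z : EuclideanSpace ℝ (Fin d) × ℝ} (hz : N (z - c) ≤ ρ) :
    |pointDist N z (hypo f) - pointDist N z (hypo g)| ≤ ρ + N (c - p) := by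
  have h := map_add_le_add N (z - c) (c - p)
  rw [sub_add_sub_cancel] at h
  have h1 := pointDist_le N z hf
  have h2 := pointDist_le N z hg
  have h3 := pointDist_nonneg N z (A := hypo f)
  have h4 := pointDist_nonneg N z (A := hypo g)
  rw [abs_sub_le_iff]
  constructor <;> linarith

theorem awDistRho_nonneg (ρ : ℝ) (f g : UscFcns S) : 0 ≤ awDistRho N c ρ f g :=
  Real.sSup_nonneg (by rintro _ ⟨z, -, rfl⟩; exact abs_nonneg _)

theorem awDistRho_le_of_forall {f g : UscFcns S} {ρ r : ℝ} (hr : 0 ≤ r)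
    (h : ∀ z, N (z - c) ≤ ρ → |pointDist N z (hypo f) - pointDist N z (hypo g)| ≤ r) :
    awDistRho N c ρ f g ≤ r :=
  Real.sSup_le (by rintro _ ⟨z, hz, rfl⟩; exact h z hz) hr

/-- Monotonicity supplies the measurability of the integrand. -/
theorem monotoneOn_awDistRho {f g : UscFcns S} (hf : p ∈ hypo f) (hg : p ∈ hypo g) :
    MonotoneOn (fun ρ => awDistRho N c ρ f g) (Set.Ioi 0) := by
  intro ρ hρ σ _ hρσ
  refine csSup_le_csSup ⟨σ + N (c - p), ?_⟩ ?_ ?_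
  · rintro _ ⟨z, hz, rfl⟩
    exact abs_pointDist_hypo_sub_le hf hg hz
  · exact ⟨_, c, by simpa using (Set.mem_Ioi.1 hρ).le, rfl⟩
  · exact Set.image_mono fun z (hz : _ ≤ ρ) => hz.trans hρσ

theorem awTendsto_of_tendstoUniformlyOn (hN : ∀ z, N z = 0 → z = 0) {u : ℕ → UscFcns S}
    {f : UscFcns S} (hu : ∀ k, p ∈ hypo (u k)) (hf : p ∈ hypo f)
    (h : ∀ K, IsCompact K → TendstoUniformlyOn (fun k z => pointDist N z (hypo (u k)))
      (fun z => pointDist N z (hypo f)) atTop K) : AwTendsto N c u f := by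
  have hlim : ∀ ρ, Tendsto (fun k => awDistRho N c ρ (u k) f) atTop (𝓝 0) := by
    intro ρ
    rw [Metric.tendsto_atTop']
    intro δ hδ
    obtain ⟨n, hn⟩ := eventually_atTop.1 (Metric.tendstoUniformlyOn_iff.1
      (h _ (isCompact_seminorm_closedBall N hN c ρ)) (δ / 2) (half_pos hδ))
    refine ⟨n, fun k hk => ?_⟩
    rw [Real.dist_eq, sub_zero, abs_of_nonneg (awDistRho_nonneg _ _ _)]
    refine (awDistRho_le_of_forall (half_pos hδ).le fun z hz => ?_).trans_lt (half_lt_self hδ)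
    have := hn k hk.le z hz
    rw [dist_comm, Real.dist_eq] at this
    exact this.le
  have hint : MeasureTheory.IntegrableOn
      (fun ρ : ℝ => (ρ + N (c - p)) * Real.exp (-ρ)) (Set.Ioi 0) := by
    -- The integral for `Γ(2)` handles the term `ρ * exp (-ρ)`.
    have h1 := Real.GammaIntegral_convergent (s := 2) two_pos
    refine (h1.add ((integrableOn_exp_neg_Ioi 0).const_mul (N (c - p)))).congr_fun
      (fun ρ _ => ?_) measurableSet_Ioi
    norm_num
    ring
  have key := MeasureTheory.tendsto_integral_of_dominated_convergence
    (μ := MeasureTheory.volume.restrict (Set.Ioi (0 : ℝ)))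
    (F := fun k ρ => awDistRho N c ρ (u k) f * Real.exp (-ρ)) (f := fun _ => 0)
    (fun ρ => (ρ + N (c - p)) * Real.exp (-ρ)) ?_ hint ?_ ?_
  · simpa [AwTendsto, awDist] using key
  · intro k
    exact ((aemeasurable_restrict_of_monotoneOn measurableSet_Ioi
      (monotoneOn_awDistRho (hu k) hf)).mul (by fun_prop)).aestronglyMeasurable
  · intro k
    filter_upwards [MeasureTheory.ae_restrict_mem measurableSet_Ioi] with ρ hρ
    rw [Real.norm_of_nonneg (mul_nonneg (awDistRho_nonneg _ _ _) (Real.exp_pos _).le)]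
    refine mul_le_mul_of_nonneg_right ?_ (Real.exp_pos _).le
    exact awDistRho_le_of_forall (add_nonneg (Set.mem_Ioi.1 hρ).le (apply_nonneg _ _))
      fun z hz => abs_pointDist_hypo_sub_le (hu k) hf hz
  · refine Eventually.of_forall fun ρ => ?_
    simpa using (hlim ρ).mul_const (Real.exp (-ρ))

/-- Sequences of usc functions whose hypographs share a point have aw-convergent subsequences. -/
theorem exists_subseq_awTendsto (hS : IsClosed S) (hN : ∀ z, N z = 0 → z = 0)
    (c : EuclideanSpace ℝ (Fin d) × ℝ) {u : ℕ → UscFcns S} (hu : ∀ k, p ∈ hypo (u k)) :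
    ∃ (f : UscFcns S) (φ : ℕ → ℕ), StrictMono φ ∧ AwTendsto N c (fun k => u (φ k)) f := by
  obtain ⟨D, φ, hφ, hD⟩ := exists_subseq_tendsto_of_nonexpansive N p
    (fun k z => pointDist N z (hypo (u k))) (fun _ z => pointDist_nonneg N z)
    (fun k => pointDist_eq_zero_of_mem N (hu k))
    (fun k z w => abs_pointDist_sub_le N (hypo_nonempty (u k)) z w)
  have hpt : ∀ z, Tendsto (fun k => pointDist N z (hypo (u (φ k)))) atTop (𝓝 (D z)) :=
    fun z => (hD {z} isCompact_singleton).tendsto_at rfl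
  have hdist := eq_pointDist_zeroSet_of_tendsto hN (fun k => hu (φ k)) hpt
  have hcont := continuous_seminorm_of_finiteDimensional N
  have hDp : D p = 0 := by
    refine tendsto_nhds_unique (hpt p) ?_
    simp only [pointDist_eq_zero_of_mem N (hu _)]
    exact tendsto_const_nhds
  obtain ⟨C, hC, hnorm⟩ := exists_norm_le_mul_seminorm N hN
  -- Zeros of `D` are limits of points of the hypographs, which carries over to the zero set both
  -- lying above `S` and being downward closed.
  have happrox : ∀ z, D z = 0 → ∃ a : ℕ → EuclideanSpace ℝ (Fin d) × ℝ,
      (∀ k, a k ∈ hypo (u (φ k))) ∧ Tendsto a atTop (𝓝 z) := by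
    intro z hz
    choose a ha hlt using fun k : ℕ => exists_lt_pointDist_add N (hypo_nonempty (u (φ k))) z
      (Nat.one_div_pos_of_nat (α := ℝ) (n := k))
    refine ⟨a, ha, ?_⟩
    rw [tendsto_iff_dist_tendsto_zero]
    have hlim := ((hpt z).add tendsto_one_div_add_atTop_nhds_zero_nat).const_mul C
    rw [hz, add_zero, mul_zero] at hlim
    refine squeeze_zero (fun _ => dist_nonneg) (fun k => ?_) hlim
    rw [dist_comm, dist_eq_norm]
    exact (hnorm _).trans (mul_le_mul_of_nonneg_left (hlt k).le hC.le)
  have hclosed : IsClosed {z | D z = 0} := by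
    rw [← isSeqClosed_iff_isClosed]
    intro w z hw hwz
    refine le_antisymm ?_ (ge_of_tendsto' (hpt z) fun k => pointDist_nonneg N z)
    have h0 : Tendsto (fun k => N (z - w k)) atTop (𝓝 0) := by
      have := (hcont.tendsto _).comp ((tendsto_const_nhds (x := z)).sub hwz)
      simpa [Function.comp_def] using this
    refine ge_of_tendsto' h0 fun k => ?_
    rw [hdist z]
    exact pointDist_le N z (hw k)
  obtain ⟨f, hf⟩ := exists_hypo_eq (S := S) hclosed ⟨p, hDp⟩
    (fun z hz => by
      obtain ⟨a, ha, hlim⟩ := happrox z hz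
      exact hS.mem_of_tendsto ((continuous_fst.tendsto z).comp hlim)
        (Eventually.of_forall fun k => (ha k).1))
    (fun z hz t ht => by
      obtain ⟨a, ha, hlim⟩ := happrox z hz
      -- Lowering `z` and `a k` by the same amount `z.2 - t` leaves their difference unchanged.
      have hshift : Tendsto (fun k => N ((z.1, t) - ((a k).1, (a k).2 - (z.2 - t)))) atTop
          (𝓝 0) := by
        have := (hcont.tendsto _).comp ((tendsto_const_nhds (x := z)).sub hlim)
        simp only [sub_self, map_zero] at this
        refine this.congr fun k => ?_
        have heq : z - a k = (z.1, t) - ((a k).1, (a k).2 - (z.2 - t)) := by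
          ext1
          · rfl
          · simp only [Prod.snd_sub]
            ring
        rw [← heq, Function.comp_apply]
      refine le_antisymm (le_of_tendsto_of_tendsto' (hpt _) hshift fun k => ?_)
        (ge_of_tendsto' (hpt _) fun k => pointDist_nonneg N _)
      exact pointDist_le N _ (hypo_mem_of_le _ (ha k) (by linarith)))
  refine ⟨f, φ, hφ, awTendsto_of_tendstoUniformlyOn (p := p) hN (fun k => hu (φ k))
    (by rw [hf]; exact hDp) fun K hK => ?_⟩
  rw [hf, ← funext hdist]
  exact hD K hK

end AwDist

/-! ### Lower semicontinuity and attainment of the infimum -/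

section Objective

variable {N : Seminorm ℝ (EuclideanSpace ℝ (Fin d) × ℝ)} {c : EuclideanSpace ℝ (Fin d) × ℝ}
  {F : Set (UscFcns S)}

/-- Since `⊥ + ⊤ = ⊥` in `EReal`, superadditivity of `liminf` needs no side condition. -/
theorem AwLsc.add {φ χ : F → EReal} (hφ : AwLsc N c φ) (hχ : AwLsc N c χ) :
    AwLsc N c fun f => φ f + χ f := fun u f h =>
  (add_le_add (hφ u f h) (hχ u f h)).trans EReal.le_liminf_add

theorem AwLsc.sum {ι : Type*} (s : Finset ι) {φ : ι → F → EReal} (hφ : ∀ i, AwLsc N c (φ i)) :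
    AwLsc N c fun f => ∑ i ∈ s, φ i f := by
  classical
  induction s using Finset.induction_on with
  | empty => intro u f _; simp
  | insert i s hi ih =>
    simp only [Finset.sum_insert hi]
    exact (hφ i).add ih

theorem AwLsc.const_mul {φ : F → EReal} (hφ : AwLsc N c φ) {r : ℝ} (hr : 0 ≤ r) :
    AwLsc N c fun f => (r : EReal) * φ f := fun u f h => by
  rw [EReal.liminf_const_mul_of_nonneg_of_ne_top (EReal.coe_nonneg.2 hr) (EReal.coe_ne_top r)]
  exact mul_le_mul_of_nonneg_left (hφ u f h) (EReal.coe_nonneg.2 hr)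

theorem empObjective_ne_bot {X : Type*} {d₀ n : ℕ} {ψ : EuclideanSpace ℝ (Fin d₀) → X → EReal}
    {x : Fin n → EuclideanSpace ℝ (Fin d₀)} {π : X → EReal} {f : X}
    (hψ : ∀ j, ψ (x j) f ≠ ⊥) (hπ : π f ≠ ⊥) : empObjective ψ x π f ≠ ⊥ := by
  have hsum : ∀ s : Finset (Fin n), ∑ j ∈ s, ψ (x j) f ≠ ⊥ := by
    intro s
    induction s using Finset.induction_on with
    | empty => simp
    | insert i s hi ih =>
      rw [Finset.sum_insert hi]
      exact EReal.add_ne_bot_iff.2 ⟨hψ i, ih⟩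
  refine EReal.add_ne_bot_iff.2 ⟨?_, hπ⟩
  have hr : (0 : ℝ) ≤ 1 / n := by positivity
  rw [Ne, EReal.mul_eq_bot]
  have h0 : ¬ ((1 / (n : ℝ) : ℝ) : EReal) < 0 := not_lt.2 (EReal.coe_nonneg.2 hr)
  have h1 : ((1 / (n : ℝ) : ℝ) : EReal) ≠ ⊥ := EReal.coe_ne_bot _
  have h2 : ((1 / (n : ℝ) : ℝ) : EReal) ≠ ⊤ := EReal.coe_ne_top _
  have h3 := hsum Finset.univ
  tauto

/-- An lsc function attains its infimum on a closed set of usc functions whose hypographs share a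
point. -/
theorem AwLsc.exists_eq_iInf (hS : IsClosed S) (hN : ∀ z, N z = 0 → z = 0) (hFne : F.Nonempty)
    (hF : AwClosed N c F) {p : EuclideanSpace ℝ (Fin d) × ℝ} (hp : ∀ f ∈ F, p ∈ hypo f)
    {φ : F → EReal} (hφ : AwLsc N c φ) : ∃ f, φ f = ⨅ g, φ g := by
  have : Nonempty F := hFne.to_subtype
  -- A minimizing sequence of values exists in `EReal` even when the infimum is infinite.
  obtain ⟨v, -, hv, hmem⟩ := exists_seq_tendsto_sInf (Set.range_nonempty φ) (OrderBot.bddBelow _)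
  choose u hu using hmem
  obtain ⟨f, σ, hσ, hlim⟩ := exists_subseq_awTendsto hS hN c fun k => hp _ (u k).2
  have hfF : f ∈ F := hF _ f (fun k => (u (σ k)).2) hlim
  refine ⟨⟨f, hfF⟩, le_antisymm ?_ (iInf_le _ _)⟩
  have h := hφ (fun k => u (σ k)) ⟨f, hfF⟩ hlim
  have hv' : Tendsto (fun k => φ (u (σ k))) atTop (𝓝 (⨅ g, φ g)) := by
    simp only [hu]
    exact hv.comp hσ.tendsto_atTop
  rwa [hv'.liminf_eq] at h

end Objective

end AttouchWets

theorem theorem3p1 {d d₀ n : ℕ} (hn : 1 ≤ n)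
    (S : Set (EuclideanSpace ℝ (Fin d))) (hSne : S.Nonempty) (hS : IsClosed S)
    (N : Seminorm ℝ (EuclideanSpace ℝ (Fin d) × ℝ)) (hN : ∀ z, N z = 0 → z = 0)
    (c : EuclideanSpace ℝ (Fin d) × ℝ) (hc : c.1 ∈ S)
    (F : Set (AttouchWets.UscFcns S)) (hFne : F.Nonempty) (hF : AttouchWets.AwClosed N c F)
    (hbound : ∃ (x : S) (α : ℝ), ∀ f ∈ F, (α : EReal) ≤ f.1 x)
    (x : Fin n → EuclideanSpace ℝ (Fin d₀))
    (ψ : EuclideanSpace ℝ (Fin d₀) → F → EReal) (π : F → EReal)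
    (hψ : ∀ j, (∀ f, ψ (x j) f ≠ ⊥) ∧ AttouchWets.AwLsc N c (ψ (x j)))
    (hπ : (∀ f, π f ≠ ⊥) ∧ AttouchWets.AwLsc N c π)
    (ε : ℝ) (hε : 0 ≤ ε) :
    (AttouchWets.epsArgmin (AttouchWets.empObjective ψ x π) ε).Nonempty ∧
      ⊥ < ⨅ f, AttouchWets.empObjective ψ x π f := by
  obtain ⟨x₀, α, hα⟩ := hbound
  have hlsc : AttouchWets.AwLsc N c (AttouchWets.empObjective ψ x π) :=
    ((AttouchWets.AwLsc.sum Finset.univ fun j => (hψ j).2).const_mul (by positivity)).add hπ.2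
  obtain ⟨f, hf⟩ := hlsc.exists_eq_iInf hS hN hFne hF (p := (x₀, α))
    fun g hg => ⟨x₀.2, hα g hg⟩
  refine ⟨⟨f, ?_⟩, ?_⟩
  -- An exact minimizer serves for every `ε ≥ 0`.
  · exact hf.le.trans (le_add_of_nonneg_right (EReal.coe_nonneg.2 hε))
  · rw [← hf, bot_lt_iff_ne_bot]
    exact AttouchWets.empObjective_ne_bot (fun j => (hψ j).1 f) (hπ.1 f)
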